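/- Let $p,q>1$ be coprime integers, and for $n\in\mathbb{N}$ let $f_{p,q}(n)$ be the number of different expressions of $n$ as a sum of distinct terms taken from $\{p^{\alpha}q^{\beta}:\alpha,\beta\in\mathbb{N}\}$, where $\mathbb{N}$ is the set of nonnegative integers and the order of the terms is disregarded. Then, for all sufficiently large integers $n$, $$ f_{p,q}(n)=2^{\frac{(\log n)^2}{2\log p\log q}\left(1+O\left(\frac{\log\log n}{\log n}\right)\right)}, $$ where the implied constant (and the bound for "sufficiently large") may depend on $p$ and $q$. That is, there is a function $\delta$ with $\delta(n)=O(\log\log n/\log n)$ as $n\to\infty$ such that $f_{p,q}(n)=2^{\frac{(\log n)^2}{2\log p\log q}(1+\delta(n))}$ for all sufficiently large $n$. -/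

import Mathlib

open Filter Asymptotics

/-- The expressions of `n` as a sum of distinct terms from `{p ^ α * q ^ β : α, β ∈ ℕ}`: an
expression is the finite set `S` of its (distinct) terms, the order of summation being
irrelevant. -/
def expressions (p q n : ℕ) : Set (Finset ℕ) :=
  {S | (∀ m ∈ S, ∃ α β : ℕ, m = p ^ α * q ^ β) ∧ ∑ m ∈ S, m = n}

/-- There are only finitely many expressions, so counting them by `Set.ncard` is meaningful. -/
theorem expressions_finite (p q n : ℕ) : (expressions p q n).Finite := by
  refine ((Finset.range (n + 1)).powerset.finite_toSet).subset ?_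
  rintro S ⟨-, hS⟩
  simp only [Finset.coe_powerset, Set.mem_preimage, Set.mem_powerset_iff, Finset.coe_subset]
  intro m hm
  have h := Finset.single_le_sum (f := fun m : ℕ => m) (fun _ _ => Nat.zero_le _) hm
  simp only [Finset.mem_range]
  omega

/-- `f_{p,q}(n)`: the number of expressions of `n` as a sum of distinct terms taken from
`{p ^ α * q ^ β : α, β ∈ ℕ}`. -/
noncomputable def numExpressions (p q n : ℕ) : ℕ := (expressions p q n).ncard

/-!
Write `L = log n`. An expression of `n` is a set of terms `p ^ α * q ^ β ≤ n`, and the exponent pairs of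
these terms are the lattice points of the triangle `α log p + β log q ≤ L`, whose area is
`L² / (2 log p log q)`. Hence `f(n) ≤ 2 ^ (area + O(L))` (`exists_logb_numExpressions_le`).

For the lower bound (`eventually_le_logb_numExpressions`) fix `J` such that every large integer is a sum
of distinct terms with `β < J` (`exists_expSum_eq_of_le`, a theorem of Birch sharpened by Davenport).
Any set of terms with `β ≥ J` and sum at most `n - n₀` then extends to an expression of `n`, and distinct
sets have distinct extensions. The terms `q ^ J * u`, where `u = p ^ α * q ^ β` is at most `n / L ^ 3`,
number `O(L²)`, so they may be chosen freely; there are at least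
`(L - 3 log L)² / (2 log p log q)` of them, which loses only `O(L log L)` in the exponent.

The representation theorem is proved as follows. The integers with infinitely many disjoint
representations as signed sums of terms form a subgroup of `ℤ` (`persistentSums`). Pure powers of `q`
hit every residue modulo `p ^ a`, and boundedly many powers of `q` times all powers of `p` have subset
sums with bounded gaps, say at most `g` (`exists_expSum_near`). So, outside any box of exponents, every
integer in a suitable range is a sum of terms plus `p ^ a * e` with `|e| ≤ g`
(`exists_eq_expSum_add_pow_mul`). Two of `2g + 2` consecutive integers share `e`, so the subgroup
is nonzero, equal to `hℤ` say; repeating the argument with `e` divisible by the part of `h` coprime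
to `p` puts `1` into it. Disjoint signed representations of `1` give runs of consecutive
representable integers (`exists_run`). A run that is long enough grows under `m = d + p x` without raising
the exponents of `q` (`exists_run_snd_lt`), and once it is longer than the gaps of the subset sums that
only involve larger powers of `q`, translates of it cover all large integers.
-/

/-! ### Sums of terms indexed by exponent pairs -/

/-- The sum of the terms `p ^ α * q ^ β` over a finite set of exponent pairs `(α, β)`. -/
def expSum (p q : ℕ) (A : Finset (ℕ × ℕ)) : ℕ := ∑ t ∈ A, p ^ t.1 * q ^ t.2

theorem expSum_union (p q : ℕ) {A B : Finset (ℕ × ℕ)} (h : Disjoint A B) :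
    expSum p q (A ∪ B) = expSum p q A + expSum p q B := Finset.sum_union h

theorem exists_expSum_shift (p q c d : ℕ) (A : Finset (ℕ × ℕ)) :
    ∃ B : Finset (ℕ × ℕ), (∀ t ∈ B, ∃ s ∈ A, t = (s.1 + c, s.2 + d)) ∧
      expSum p q B = p ^ c * q ^ d * expSum p q A ∧ B.card = A.card := by
  have hinj : Function.Injective fun s : ℕ × ℕ => (s.1 + c, s.2 + d) := by
    rintro ⟨a, b⟩ ⟨a', b'⟩ h
    simp only [Prod.mk.injEq] at h ⊢
    omega
  refine ⟨A.image fun s => (s.1 + c, s.2 + d), ?_, ?_, Finset.card_image_of_injective A hinj⟩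
  · intro t ht
    obtain ⟨s, hs, rfl⟩ := Finset.mem_image.1 ht
    exact ⟨s, hs, rfl⟩
  · unfold expSum
    rw [Finset.sum_image fun _ _ _ _ h => hinj h, Finset.mul_sum]
    refine Finset.sum_congr rfl fun s _ => ?_
    ring

/-- Sums of distinct powers of `b` with large exponents hit every residue class of a modulus coprime
to `b`, with a bound independent of the class: the powers `b ^ (φ(m) i)` are all `1` modulo `m`. -/
theorem exists_sum_pow_modEq {b m : ℕ} (hm : 0 < m) (hb : Nat.Coprime b m) (N : ℕ) :
    ∃ K M : ℕ, ∀ c : ℕ, ∃ E : Finset ℕ, (∀ i ∈ E, N ≤ i ∧ i < K) ∧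
      ∑ i ∈ E, b ^ i ≡ c [MOD m] ∧ ∑ i ∈ E, b ^ i ≤ M := by
  have hφ : 0 < m.totient := Nat.totient_pos.2 hm
  have hinj : Function.Injective fun i : ℕ => m.totient * (i + N) := by
    intro i j h
    have := Nat.eq_of_mul_eq_mul_left hφ h
    omega
  refine ⟨m.totient * (m + N), ∑ i ∈ Finset.range m, b ^ (m.totient * (i + N)), fun c => ?_⟩
  refine ⟨(Finset.range (c % m)).image fun i => m.totient * (i + N), ?_, ?_, ?_⟩
  · intro i hi
    obtain ⟨k, hk, rfl⟩ := Finset.mem_image.1 hi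
    have hk' : k < m := (Finset.mem_range.1 hk).trans (Nat.mod_lt _ hm)
    exact ⟨by nlinarith, Nat.mul_lt_mul_of_pos_left (by omega) hφ⟩
  · rw [Finset.sum_image fun _ _ _ _ h => hinj h]
    have h1 : ∀ i ∈ Finset.range (c % m), b ^ (m.totient * (i + N)) ≡ 1 [MOD m] := by
      intro i _
      rw [pow_mul]
      simpa using (Nat.ModEq.pow_totient hb).pow (i + N)
    have h2 : ∑ i ∈ Finset.range (c % m), b ^ (m.totient * (i + N)) ≡
        ∑ i ∈ Finset.range (c % m), 1 [MOD m] := Nat.ModEq.sum h1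
    refine h2.trans ?_
    simpa using Nat.mod_modEq c m
  · rw [Finset.sum_image fun _ _ _ _ h => hinj h]
    exact Finset.sum_le_sum_of_subset
      (Finset.range_subset_range.2 (Nat.mod_lt _ hm).le)

theorem exists_expSum_eq_sum_pow_left (p q : ℕ) (E : Finset ℕ) :
    ∃ A : Finset (ℕ × ℕ), (∀ t ∈ A, t.1 ∈ E ∧ t.2 = 0) ∧ expSum p q A = ∑ i ∈ E, p ^ i := by
  refine ⟨E ×ˢ {0}, ?_, ?_⟩
  · rintro ⟨i, j⟩ h
    simpa [eq_comm] using h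
  · simp [expSum]

theorem exists_expSum_eq_sum_pow_right (p q : ℕ) (E : Finset ℕ) :
    ∃ A : Finset (ℕ × ℕ), (∀ t ∈ A, t.1 = 0 ∧ t.2 ∈ E) ∧ expSum p q A = ∑ j ∈ E, q ^ j := by
  refine ⟨{0} ×ˢ E, ?_, ?_⟩
  · rintro ⟨i, j⟩ h
    simpa [eq_comm, and_comm] using h
  · simp [expSum]

/-! ### Subset sums with bounded gaps -/

/-- The greedy principle: if no term exceeds the sum of its predecessors by more than `g`, then the
subset sums leave no gap longer than `g`. -/
theorem exists_subset_sum_of_le {t : ℕ → ℕ} {g : ℕ}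
    (ht : ∀ n, t n ≤ g + ∑ i ∈ Finset.range n, t i) (n x : ℕ)
    (hx : x < g + ∑ i ∈ Finset.range n, t i) :
    ∃ A ⊆ Finset.range n, ∑ i ∈ A, t i ≤ x ∧ x < ∑ i ∈ A, t i + g := by
  induction n generalizing x with
  | zero => exact ⟨∅, by simp, by simp, by simpa using hx⟩
  | succ n ih =>
    rw [Finset.sum_range_succ] at hx
    by_cases hlt : x < g + ∑ i ∈ Finset.range n, t i
    · obtain ⟨A, hA, h⟩ := ih x hlt
      exact ⟨A, hA.trans (Finset.range_subset_range.2 n.le_succ), h⟩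
    · have := ht n
      obtain ⟨A, hA, h1, h2⟩ := ih (x - t n) (by omega)
      have hn : n ∉ A := fun h => by simpa using hA h
      refine ⟨insert n A, ?_, ?_⟩
      · intro i hi
        rcases Finset.mem_insert.1 hi with rfl | hi
        · simp
        · exact Finset.mem_range.2 ((Finset.mem_range.1 (hA hi)).trans n.lt_succ_self)
      · rw [Finset.sum_insert hn]
        omega

/-- Boundedly many powers of `q`, each multiplied by all powers of `p`, already have subset sums with
bounded gaps. With `K = p ^ 2`, the `K` numbers `p ^ (s - ⌊log_p q ^ j⌋) * q ^ j`, `j < K`, all lie in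
`[p ^ s, p ^ (s + 1))`, so together they exceed each of the numbers formed in the same way
for `s + 1`, and the greedy principle applies. -/
theorem exists_expSum_near {p q : ℕ} (hp : 1 < p) (hq : 1 < q) :
    ∃ K g : ℕ, ∀ x : ℕ, ∃ A : Finset (ℕ × ℕ), (∀ t ∈ A, t.2 < K) ∧
      expSum p q A ≤ x ∧ x < expSum p q A + g := by
  set K := p ^ 2 with hK
  have hKpos : 0 < K := by positivity
  set s₀ := Nat.log p (q ^ K) with hs₀
  have hlog : ∀ n, Nat.log p (q ^ (n % K)) ≤ s₀ + n / K := fun n =>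
    (Nat.log_mono_right (Nat.pow_le_pow_right (by omega) (Nat.mod_lt n hKpos).le)).trans
      (Nat.le_add_right _ _)
  set e : ℕ → ℕ × ℕ := fun n => (s₀ + n / K - Nat.log p (q ^ (n % K)), n % K) with he
  have heinj : Function.Injective e := by
    intro m n h
    simp only [he, Prod.mk.injEq] at h
    obtain ⟨h1, h2⟩ := h
    have h4 : m / K = n / K := by
      have h3 := hlog m
      rw [h2] at h1 h3
      exact Nat.add_left_cancel ((tsub_left_inj h3 (hlog n)).1 h1)
    rw [← Nat.div_add_mod m K, ← Nat.div_add_mod n K, h2, h4]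
  set t : ℕ → ℕ := fun n => p ^ (e n).1 * q ^ (e n).2 with ht
  have hlow : ∀ n, p ^ (s₀ + n / K) ≤ t n := by
    intro n
    calc p ^ (s₀ + n / K)
        = p ^ (s₀ + n / K - Nat.log p (q ^ (n % K))) * p ^ Nat.log p (q ^ (n % K)) := by
          rw [← pow_add, Nat.sub_add_cancel (hlog n)]
      _ ≤ t n := Nat.mul_le_mul_left _ (Nat.pow_log_le_self p (by positivity))
  have hup : ∀ n, t n ≤ p ^ (s₀ + n / K + 1) := by
    intro n
    calc t n ≤ p ^ (s₀ + n / K - Nat.log p (q ^ (n % K))) * p ^ (Nat.log p (q ^ (n % K)) + 1) :=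
          Nat.mul_le_mul_left _ (Nat.lt_pow_succ_log_self hp _).le
      _ = p ^ (s₀ + n / K + 1) := by
        rw [← pow_add, ← add_assoc, Nat.sub_add_cancel (hlog n)]
  have hgrow : ∀ n, t n ≤ p ^ (s₀ + 1) + ∑ i ∈ Finset.range n, t i := by
    intro n
    rcases Nat.lt_or_ge n K with hn | hn
    · have := hup n
      rw [Nat.div_eq_of_lt hn] at this
      exact this.trans (Nat.le_add_right _ _)
    · refine le_trans ?_ (Nat.le_add_left _ _)
      obtain ⟨l, hl⟩ : ∃ l, n / K = l + 1 :=
        ⟨n / K - 1, by have := Nat.div_pos hn hKpos; omega⟩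
      have hsub : Finset.Ico (l * K) ((l + 1) * K) ⊆ Finset.range n := by
        intro i hi
        have h1 := (Finset.mem_Ico.1 hi).2
        have h2 := Nat.div_mul_le_self n K
        rw [hl] at h2
        exact Finset.mem_range.2 (by omega)
      calc t n ≤ p ^ (s₀ + n / K + 1) := hup n
        _ = K * p ^ (s₀ + l) := by rw [hl, hK]; ring
        _ = ∑ i ∈ Finset.Ico (l * K) ((l + 1) * K), p ^ (s₀ + l) := by
          rw [Finset.sum_const, Nat.card_Ico, smul_eq_mul, ← Nat.sub_mul]; simp
        _ ≤ ∑ i ∈ Finset.Ico (l * K) ((l + 1) * K), t i := by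
          refine Finset.sum_le_sum fun i hi => ?_
          have : i / K = l := by
            have := Finset.mem_Ico.1 hi
            exact Nat.div_eq_of_lt_le this.1 this.2
          simpa [this] using hlow i
        _ ≤ ∑ i ∈ Finset.range n, t i := Finset.sum_le_sum_of_subset hsub
  refine ⟨K, p ^ (s₀ + 1), fun x => ?_⟩
  have htpos : ∀ i, 1 ≤ t i := fun i => (Nat.one_le_pow _ _ (by omega)).trans (hlow i)
  have hlarge : x < p ^ (s₀ + 1) + ∑ i ∈ Finset.range x, t i := by
    have h1 : ∑ i ∈ Finset.range x, 1 ≤ ∑ i ∈ Finset.range x, t i :=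
      Finset.sum_le_sum fun i _ => htpos i
    have h2 : 0 < p ^ (s₀ + 1) := by positivity
    simp only [Finset.sum_const, Finset.card_range, smul_eq_mul, mul_one] at h1
    omega
  obtain ⟨A, -, h1, h2⟩ := exists_subset_sum_of_le hgrow x x hlarge
  have hsum : expSum p q (A.image e) = ∑ i ∈ A, t i := Finset.sum_image fun _ _ _ _ h => heinj h
  refine ⟨A.image e, ?_, by rwa [hsum], by rwa [hsum]⟩
  intro u hu
  obtain ⟨i, -, rfl⟩ := Finset.mem_image.1 hu
  exact Nat.mod_lt _ hKpos

/-- Sums of terms approximate every integer with bounded error, the error being moreover divisible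
by a prescribed modulus coprime to `p`. The terms used for the size are multiples of `q`, which leaves
the pure powers of `p` free to correct the residue. -/
theorem exists_expSum_near_modEq {p q h : ℕ} (hp : 1 < p) (hq : 1 < q) (hh : 0 < h)
    (hph : Nat.Coprime p h) :
    ∃ g : ℕ, ∀ x : ℕ, ∃ A : Finset (ℕ × ℕ),
      |(x : ℤ) - expSum p q A| ≤ g ∧ (h : ℤ) ∣ (x : ℤ) - expSum p q A := by
  obtain ⟨K, g, hg⟩ := exists_expSum_near hp hq
  obtain ⟨_, M, hM⟩ := exists_sum_pow_modEq hh hph 0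
  refine ⟨M + q * (g + 1), fun x => ?_⟩
  obtain ⟨A₀, -, h1, h2⟩ := hg (x / q)
  obtain ⟨A, hA, hAs, -⟩ := exists_expSum_shift p q 0 1 A₀
  rw [pow_zero, one_mul, pow_one] at hAs
  have hAx : expSum p q A ≤ x := by
    rw [hAs]
    exact (Nat.mul_le_mul_left q h1).trans (Nat.mul_div_le x q)
  have hxA : x ≤ expSum p q A + q * (g + 1) := by
    have h3 : x < q * (x / q + 1) := Nat.lt_mul_div_succ x (by omega)
    have h4 : q * (x / q + 1) ≤ q * (expSum p q A₀ + (g + 1)) := Nat.mul_le_mul_left q (by omega)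
    rw [Nat.mul_add q (expSum p q A₀)] at h4
    omega
  obtain ⟨E, -, hEm, hEM⟩ := hM (x - expSum p q A)
  obtain ⟨B, hB, hBs⟩ := exists_expSum_eq_sum_pow_left p q E
  have hdisj : Disjoint A B := by
    rw [Finset.disjoint_left]
    intro t htA htB
    obtain ⟨s, -, rfl⟩ := hA t htA
    simpa using (hB _ htB).2
  refine ⟨A ∪ B, ?_, ?_⟩
  · rw [expSum_union p q hdisj, hBs, abs_le]
    push_cast
    zify at hAx hxA hEM
    constructor <;> nlinarith
  · rw [expSum_union p q hdisj, hBs]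
    have := hEm.dvd
    rw [Nat.cast_sub hAx] at this
    convert this using 1
    push_cast
    ring

/-! ### Integers with disjoint signed representations -/

/-- The integers `∑ A - ∑ B` where `A` and `B` are finite sets of terms `p ^ α * q ^ β` whose exponent
pairs lie outside the box `[0, N)²`. The sets may overlap: common terms cancel. -/
def signedSums (p q N : ℕ) : Set ℤ :=
  {x | ∃ A B : Finset (ℕ × ℕ), (∀ t ∈ A, N ≤ t.1 ∨ N ≤ t.2) ∧ (∀ t ∈ B, N ≤ t.1 ∨ N ≤ t.2) ∧
    x = (expSum p q A : ℤ) - expSum p q B}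

theorem signedSums_antitone (p q : ℕ) : Antitone (signedSums p q) := by
  rintro M N hMN x ⟨A, B, hA, hB, h⟩
  exact ⟨A, B, fun t ht => (hA t ht).imp hMN.trans hMN.trans,
    fun t ht => (hB t ht).imp hMN.trans hMN.trans, h⟩

theorem exists_box (A : Finset (ℕ × ℕ)) : ∃ N : ℕ, ∀ t ∈ A, t.1 < N ∧ t.2 < N := by
  refine ⟨A.sup (fun t => t.1 + t.2) + 1, fun t ht => ?_⟩
  have : t.1 + t.2 ≤ _ := Finset.le_sup (f := fun t : ℕ × ℕ => t.1 + t.2) ht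
  omega

theorem disjoint_of_box {A B : Finset (ℕ × ℕ)} {N : ℕ} (hA : ∀ t ∈ A, t.1 < N ∧ t.2 < N)
    (hB : ∀ t ∈ B, N ≤ t.1 ∨ N ≤ t.2) : Disjoint A B := by
  rw [Finset.disjoint_left]
  intro t h1 h2
  have := hA t h1
  have := hB t h2
  omega

/-- An integer that is a signed sum outside every box can be added to any signed sum: choose its
representation outside a box containing the terms already used. -/
theorem add_mem_signedSums {p q N : ℕ} {x y : ℤ} (hx : x ∈ signedSums p q N)
    (hy : ∀ M, y ∈ signedSums p q M) : x + y ∈ signedSums p q N := by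
  obtain ⟨A, B, hA, hB, rfl⟩ := hx
  obtain ⟨M, hM⟩ := exists_box (A ∪ B)
  obtain ⟨C, D, hC, hD, rfl⟩ := hy (max M N)
  have hAC : Disjoint A C := disjoint_of_box (fun t ht => hM t (Finset.mem_union_left _ ht))
    fun t ht => (hC t ht).imp (le_max_left M N).trans (le_max_left M N).trans
  have hBD : Disjoint B D := disjoint_of_box (fun t ht => hM t (Finset.mem_union_right _ ht))
    fun t ht => (hD t ht).imp (le_max_left M N).trans (le_max_left M N).trans
  refine ⟨A ∪ C, B ∪ D, ?_, ?_, ?_⟩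
  · intro t ht
    exact (Finset.mem_union.1 ht).elim (hA t)
      fun h => (hC t h).imp (le_max_right M N).trans (le_max_right M N).trans
  · intro t ht
    exact (Finset.mem_union.1 ht).elim (hB t)
      fun h => (hD t h).imp (le_max_right M N).trans (le_max_right M N).trans
  · rw [expSum_union p q hAC, expSum_union p q hBD]
    push_cast
    ring

/-- The group of integers that are signed sums of terms outside every box, that is, those with
infinitely many pairwise disjoint signed representations. -/
def persistentSums (p q : ℕ) : AddSubgroup ℤ where
  carrier := {x | ∀ N, x ∈ signedSums p q N}
  zero_mem' := fun N => ⟨∅, ∅, by simp, by simp, by simp⟩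
  add_mem' := fun hx hy N => add_mem_signedSums (hx N) hy
  neg_mem' := by
    intro x hx N
    obtain ⟨A, B, hA, hB, rfl⟩ := hx N
    exact ⟨B, A, hB, hA, by ring⟩

theorem mem_persistentSums {p q : ℕ} {x : ℤ} :
    x ∈ persistentSums p q ↔ ∀ N, x ∈ signedSums p q N := Iff.rfl

/-- All integers beyond some `Z` agree with a sum of terms outside a given box up to an error `p ^ a * e`
with `a` large, `e` bounded independently of the box, and `e` divisible by a prescribed modulus.
Pure powers of `q` make the difference divisible by `p ^ a`, and the quotient is then approximated by
a sum of terms. -/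
theorem exists_eq_expSum_add_pow_mul {p q h : ℕ} (hp : 1 < p) (hq : 1 < q) (hpq : Nat.Coprime p q)
    (hh : 0 < h) (hph : Nat.Coprime p h) :
    ∃ g : ℕ, ∀ N : ℕ, ∃ a Z : ℕ, N ≤ a ∧ ∀ r : ℕ, ∃ (A : Finset (ℕ × ℕ)) (e : ℤ),
      (∀ t ∈ A, N ≤ t.1 ∨ N ≤ t.2) ∧ (Z : ℤ) + r = expSum p q A + p ^ a * e ∧
      |e| ≤ g ∧ (h : ℤ) ∣ e := by
  obtain ⟨g, hg⟩ := exists_expSum_near_modEq hp hq hh hph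
  refine ⟨g, fun N => ?_⟩
  have hpa : 0 < p ^ (N + 1) := by positivity
  obtain ⟨_, M, hM⟩ := exists_sum_pow_modEq hpa (hpq.symm.pow_right (N + 1)) N
  refine ⟨N + 1, M, by omega, fun r => ?_⟩
  obtain ⟨E, hE, hEm, hEM⟩ := hM (M + r)
  obtain ⟨A, hA, hAs⟩ := exists_expSum_eq_sum_pow_right p q E
  obtain ⟨x, hx⟩ := (Nat.modEq_iff_dvd' (by omega)).1 hEm
  obtain ⟨B₀, hB₀, hB₀d⟩ := hg x
  obtain ⟨B, hB, hBs, -⟩ := exists_expSum_shift p q (N + 1) 0 B₀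
  have hdisj : Disjoint A B := by
    rw [Finset.disjoint_left]
    intro t htA htB
    obtain ⟨s, -, rfl⟩ := hB t htB
    simpa using (hA _ htA).1
  refine ⟨A ∪ B, x - expSum p q B₀, ?_, ?_, hB₀, hB₀d⟩
  · intro t ht
    rcases Finset.mem_union.1 ht with ht | ht
    · exact Or.inr (hE _ (hA t ht).2).1
    · obtain ⟨s, -, rfl⟩ := hB t ht
      left
      simp only
      omega
  · rw [expSum_union p q hdisj, hBs, hAs]
    have hx' : M + r = ∑ i ∈ E, q ^ i + p ^ (N + 1) * x := by omega
    zify at hx'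
    rw [hx']
    push_cast
    ring

/-- Two of the integers `Z, …, Z + 2g + 1` have the same error term, so their difference is a signed sum
outside the box; some value of the difference occurs for all boxes. -/
theorem exists_pos_mem_persistentSums {p q : ℕ} (hp : 1 < p) (hq : 1 < q)
    (hpq : Nat.Coprime p q) : ∃ d : ℕ, 0 < d ∧ (d : ℤ) ∈ persistentSums p q := by
  obtain ⟨g, hg⟩ := exists_eq_expSum_add_pow_mul hp hq hpq one_pos (Nat.coprime_one_right p)
  have key : ∀ N, ∃ d ∈ Finset.Icc 1 (2 * g + 1), (d : ℤ) ∈ signedSums p q N := by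
    intro N
    obtain ⟨a, Z, -, hZ⟩ := hg N
    choose A e hA hsum he _ using hZ
    have hcard : (Finset.Icc (-(g : ℤ)) g).card < (Finset.range (2 * g + 2)).card := by
      rw [Int.card_Icc, Finset.card_range]
      omega
    obtain ⟨r, hr, r', hr', hne, heq⟩ := Finset.exists_ne_map_eq_of_card_lt_of_maps_to hcard
      (f := e) fun r _ => by simpa [abs_le] using he r
    rw [Finset.mem_range] at hr hr'
    wlog hlt : r < r' generalizing r r'
    · exact this r' hr' r hr hne.symm heq.symm (by omega)
    refine ⟨r' - r, by rw [Finset.mem_Icc]; omega, A r', A r, hA r', hA r, ?_⟩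
    have h1 := hsum r
    have h2 := hsum r'
    rw [heq] at h1
    rw [Nat.cast_sub hlt.le]
    linarith
  by_contra! hcon
  have hbad : ∀ d : ℕ, ∃ N, 0 < d → (d : ℤ) ∉ signedSums p q N := by
    intro d
    rcases Nat.eq_zero_or_pos d with rfl | hd
    · exact ⟨0, fun h => absurd h (lt_irrefl 0)⟩
    · have := hcon d hd
      rw [mem_persistentSums, not_forall] at this
      exact this.imp fun N hN _ => hN
  choose F hF using hbad
  obtain ⟨d, hd, hmem⟩ := key ((Finset.Icc 1 (2 * g + 1)).sup F)
  exact hF d (Finset.mem_Icc.1 hd).1 (signedSums_antitone p q (Finset.le_sup hd) hmem)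

theorem exists_dvd_pow_mul_coprime (p : ℕ) {h : ℕ} (hh : 0 < h) :
    ∃ s h' : ℕ, 0 < h' ∧ Nat.Coprime p h' ∧ h ∣ p ^ s * h' := by
  induction h using Nat.strong_induction_on with
  | _ h ih =>
    by_cases hc : Nat.Coprime p h
    · exact ⟨0, h, hh, hc, by simp⟩
    · obtain ⟨k, hk⟩ := Nat.gcd_dvd_right p h
      have hg0 : 0 < Nat.gcd p h := Nat.gcd_pos_of_pos_right p hh
      have hg1 : Nat.gcd p h ≠ 1 := hc
      have hk0 : 0 < k := Nat.pos_of_ne_zero fun h0 => by simp [h0] at hk; omega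
      obtain ⟨s, h', h0, hcop, hdvd⟩ := ih k (by nlinarith [show 2 ≤ Nat.gcd p h by omega]) hk0
      refine ⟨s + 1, h', h0, hcop, ?_⟩
      rw [hk, pow_succ', mul_assoc]
      exact mul_dvd_mul (Nat.gcd_dvd_left p h) hdvd

/-- The group is `hℤ` with `h ≠ 0`. Taking error terms divisible by the part of `h` coprime to `p`, and
`p ^ a` divisible by the rest, the errors for `Z` and `Z + 1` differ by an element of the group. -/
theorem one_mem_persistentSums {p q : ℕ} (hp : 1 < p) (hq : 1 < q) (hpq : Nat.Coprime p q) :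
    (1 : ℤ) ∈ persistentSums p q := by
  obtain ⟨d, hd, hdmem⟩ := exists_pos_mem_persistentSums hp hq hpq
  obtain ⟨s, h, hh, hcop, hdvd⟩ := exists_dvd_pow_mul_coprime p hd
  obtain ⟨g, hg⟩ := exists_eq_expSum_add_pow_mul hp hq hpq hh hcop
  intro N
  obtain ⟨a, Z, ha, hZ⟩ := hg (max N s)
  obtain ⟨A, e, hA, hAs, -, he⟩ := hZ 0
  obtain ⟨B, e', hB, hBs, -, he'⟩ := hZ 1
  have hmem : (p : ℤ) ^ a * (e' - e) ∈ persistentSums p q := by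
    have h1 : (d : ℤ) ∣ (p : ℤ) ^ a * (e' - e) := by
      refine (Int.natCast_dvd_natCast.2 hdvd).trans ?_
      push_cast
      exact mul_dvd_mul (pow_dvd_pow _ ((le_max_right N s).trans ha)) (dvd_sub he' he)
    exact AddSubgroup.zmultiples_le_of_mem hdmem (Int.mem_zmultiples_iff.2 h1)
  have hdiff : (expSum p q B : ℤ) - expSum p q A ∈ signedSums p q N :=
    signedSums_antitone p q (le_max_left N s) ⟨B, A, hB, hA, rfl⟩
  have := add_mem_signedSums hdiff hmem
  convert this using 1
  push_cast at hAs hBs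
  linarith

/-! ### Every large integer is a sum of distinct terms with bounded exponent of `q` -/

/-- Disjoint signed representations of `1` turn into arbitrarily long runs of integers that are sums
of terms: put all negative parts into the base point and switch from negative to positive parts one by
one. -/
theorem exists_run {p q : ℕ} (hp : 1 < p) (hq : 1 < q) (hpq : Nat.Coprime p q) (L : ℕ) :
    ∃ U N : ℕ, ∀ l ≤ L, ∃ A : Finset (ℕ × ℕ), (∀ t ∈ A, t.1 < N ∧ t.2 < N) ∧
      expSum p q A = U + l := by
  induction L with
  | zero => exact ⟨0, 0, fun l hl => ⟨∅, by simp, by simp [expSum]; omega⟩⟩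
  | succ L ih =>
    obtain ⟨U, N, hU⟩ := ih
    obtain ⟨C, D, hC, hD, hCD⟩ := mem_persistentSums.1 (one_mem_persistentSums hp hq hpq) N
    obtain ⟨M, hM⟩ := exists_box (C ∪ D)
    have hbox : ∀ A B : Finset (ℕ × ℕ), (∀ t ∈ A, t.1 < N ∧ t.2 < N) → B ⊆ C ∪ D →
        ∀ t ∈ A ∪ B, t.1 < max N M ∧ t.2 < max N M := by
      intro A B hA hB t ht
      rcases Finset.mem_union.1 ht with ht | ht
      · exact ⟨lt_max_of_lt_left (hA t ht).1, lt_max_of_lt_left (hA t ht).2⟩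
      · exact ⟨lt_max_of_lt_right (hM t (hB ht)).1, lt_max_of_lt_right (hM t (hB ht)).2⟩
    refine ⟨U + expSum p q D, max N M, fun l hl => ?_⟩
    rcases Nat.lt_or_ge L l with h | h
    · obtain ⟨A, hA, hAs⟩ := hU L le_rfl
      refine ⟨A ∪ C, hbox A C hA Finset.subset_union_left, ?_⟩
      rw [expSum_union p q (disjoint_of_box hA hC)]
      omega
    · obtain ⟨A, hA, hAs⟩ := hU l h
      refine ⟨A ∪ D, hbox A D hA Finset.subset_union_right, ?_⟩
      rw [expSum_union p q (disjoint_of_box hA hD)]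
      omega

/-- The runs can be made arbitrarily long without raising the exponents of `q`: a run `[U, U + L]` yields
a run from `p U + M` to `p (U + L)`, writing `m = d + p x` with `d ≤ M` a sum of pure powers of `q`. -/
theorem exists_run_snd_lt {p q : ℕ} (hp : 1 < p) (hq : 1 < q) (hpq : Nat.Coprime p q) :
    ∃ J : ℕ, ∀ L : ℕ, ∃ U : ℕ, ∀ l ≤ L, ∃ A : Finset (ℕ × ℕ), (∀ t ∈ A, t.2 < J) ∧
      expSum p q A = U + l := by
  obtain ⟨K, M, hM⟩ := exists_sum_pow_modEq (by omega : 0 < p) hpq.symm 0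
  obtain ⟨U₀, N, hN⟩ := exists_run hp hq hpq (M + 1)
  refine ⟨max K N, fun L => ?_⟩
  -- Runs shorter than `M + 1` need not grow, so the induction starts at length `M + 1`.
  suffices h : ∀ k, ∃ U : ℕ, ∀ l ≤ M + 1 + k, ∃ A : Finset (ℕ × ℕ), (∀ t ∈ A, t.2 < max K N) ∧
      expSum p q A = U + l by
    obtain ⟨U, hU⟩ := h L
    exact ⟨U, fun l hl => hU l (by omega)⟩
  intro k
  induction k with
  | zero =>
    refine ⟨U₀, fun l hl => ?_⟩
    obtain ⟨A, hA, hAs⟩ := hN l hl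
    exact ⟨A, fun t ht => lt_max_of_lt_right (hA t ht).2, hAs⟩
  | succ k ih =>
    obtain ⟨U, hU⟩ := ih
    refine ⟨p * U + M, fun l hl => ?_⟩
    obtain ⟨E, hE, hEm, hEM⟩ := hM (p * U + M + l)
    obtain ⟨A, hA, hAs⟩ := exists_expSum_eq_sum_pow_right p q E
    obtain ⟨x, hx⟩ := (Nat.modEq_iff_dvd' (by omega)).1 hEm
    have hxU : U ≤ x := by
      refine Nat.le_of_mul_le_mul_left (?_ : p * U ≤ p * x) (by omega)
      omega
    have hxL : x ≤ U + (M + 1 + k) := by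
      refine Nat.le_of_mul_le_mul_left (?_ : p * x ≤ p * (U + (M + 1 + k))) (by omega)
      have : 2 * (M + 1 + k) ≤ p * (M + 1 + k) := Nat.mul_le_mul_right _ hp
      rw [Nat.mul_add]
      omega
    obtain ⟨B₀, hB₀, hB₀s⟩ := hU (x - U) (by omega)
    obtain ⟨B, hB, hBs, -⟩ := exists_expSum_shift p q 1 0 B₀
    have hdisj : Disjoint A B := by
      rw [Finset.disjoint_left]
      intro t htA htB
      obtain ⟨s, -, rfl⟩ := hB t htB
      simpa using (hA _ htA).1
    refine ⟨A ∪ B, ?_, ?_⟩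
    · intro t ht
      rcases Finset.mem_union.1 ht with ht | ht
      · exact lt_max_of_lt_left (hE _ (hA t ht).2).2
      · obtain ⟨s, hs, rfl⟩ := hB t ht
        exact hB₀ s hs
    · rw [expSum_union p q hdisj, hBs, hAs, hB₀s, Nat.add_sub_cancel' hxU]
      simp only [pow_one, pow_zero, mul_one]
      omega

/-- The theorem of Birch in the form observed by Davenport: every large integer is a sum of distinct
terms `p ^ α * q ^ β` with `β` bounded. -/
theorem exists_expSum_eq_of_le {p q : ℕ} (hp : 1 < p) (hq : 1 < q) (hpq : Nat.Coprime p q) :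
    ∃ J n₀ : ℕ, ∀ n, n₀ ≤ n → ∃ A : Finset (ℕ × ℕ), (∀ t ∈ A, t.2 < J) ∧ expSum p q A = n := by
  obtain ⟨J, hJ⟩ := exists_run_snd_lt hp hq hpq
  obtain ⟨K, g, hg⟩ := exists_expSum_near hp hq
  have hqJ : 0 < q ^ J := by positivity
  obtain ⟨U, hU⟩ := hJ (q ^ J * (g + 1))
  refine ⟨J + K, U, fun n hn => ?_⟩
  obtain ⟨A₀, hA₀, h1, h2⟩ := hg ((n - U) / q ^ J)
  obtain ⟨A, hA, hAs, -⟩ := exists_expSum_shift p q 0 J A₀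
  rw [pow_zero, one_mul] at hAs
  have hle : expSum p q A ≤ n - U := by
    rw [hAs]
    exact (Nat.mul_le_mul_left _ h1).trans (Nat.mul_div_le _ _)
  have hge : n - U ≤ expSum p q A + q ^ J * (g + 1) := by
    have h3 := Nat.lt_mul_div_succ (n - U) hqJ
    have h4 : q ^ J * ((n - U) / q ^ J + 1) ≤ q ^ J * (expSum p q A₀ + (g + 1)) :=
      Nat.mul_le_mul_left _ (by omega)
    rw [Nat.mul_add _ (expSum p q A₀)] at h4
    omega
  obtain ⟨B, hB, hBs⟩ := hU (n - U - expSum p q A) (by omega)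
  have hdisj : Disjoint A B := by
    rw [Finset.disjoint_left]
    intro t htA htB
    obtain ⟨s, -, rfl⟩ := hA t htA
    have := hB _ htB
    simp only at this
    omega
  refine ⟨A ∪ B, ?_, ?_⟩
  · intro t ht
    rcases Finset.mem_union.1 ht with ht | ht
    · obtain ⟨s, hs, rfl⟩ := hA t ht
      have := hA₀ s hs
      simp only
      omega
    · exact (hB t ht).trans_le (Nat.le_add_right _ _)
  · rw [expSum_union p q hdisj]
    omega

/-! ### Lattice points in a triangle -/

theorem sum_range_sub_mul (x b : ℝ) (n : ℕ) :
    ∑ j ∈ Finset.range (n + 1), (x - j * b) = (n + 1) * (2 * x - n * b) / 2 := by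
  induction n with
  | zero => simp
  | succ n ih =>
    rw [Finset.sum_range_succ, ih]
    push_cast
    ring

/-- A set containing all lattice points of a triangle has at least as many elements as the area of the
triangle. -/
theorem le_card_of_triangle_subset {a b x : ℝ} (ha : 0 < a) (hb : 0 < b) (hx : 0 ≤ x)
    {D : Finset (ℕ × ℕ)} (hD : ∀ i j : ℕ, i * a + j * b ≤ x → (i, j) ∈ D) :
    x ^ 2 / (2 * a * b) ≤ D.card := by
  set B := ⌊x / b⌋₊ with hB
  have hB1 : B * b ≤ x := (le_div_iff₀ hb).1 (Nat.floor_le (by positivity))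
  have hB2 : x < (B + 1) * b := (div_lt_iff₀ hb).1 (Nat.lt_floor_add_one _)
  set W := (Finset.range (B + 1)).sigma fun j => Finset.range (⌊(x - j * b) / a⌋₊ + 1) with hW
  have hWD : W.card ≤ D.card := by
    refine Finset.card_le_card_of_injOn (fun s => (s.2, s.1)) ?_ ?_
    · rintro ⟨j, i⟩ hs
      simp only [hW, Finset.coe_sigma, Set.mem_sigma_iff, Finset.mem_coe, Finset.mem_range,
        Nat.lt_succ_iff] at hs
      obtain ⟨hj, hi⟩ := hs
      have hj' : (j : ℝ) ≤ B := Nat.cast_le.2 hj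
      have h0 : 0 ≤ x - j * b := by nlinarith
      have h1 : (i : ℝ) ≤ (x - j * b) / a := (Nat.le_floor_iff (by positivity)).1 hi
      rw [le_div_iff₀ ha] at h1
      exact hD i j (by linarith)
    · rintro ⟨j, i⟩ - ⟨j', i'⟩ - h
      simp only [Prod.mk.injEq] at h
      obtain ⟨rfl, rfl⟩ := h
      rfl
  have hsum : ∑ j ∈ Finset.range (B + 1), (x - j * b) / a ≤ W.card := by
    rw [hW, Finset.card_sigma]
    push_cast
    refine Finset.sum_le_sum fun j _ => ?_
    rw [Finset.card_range]
    push_cast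
    exact (Nat.lt_floor_add_one _).le
  rw [← Finset.sum_div, sum_range_sub_mul] at hsum
  refine le_trans ?_ (hsum.trans (Nat.cast_le.2 hWD))
  rw [div_div, div_le_div_iff₀ (by positivity) (by positivity)]
  have h : x ^ 2 ≤ ((B : ℝ) + 1) * (2 * x - B * b) * b := by nlinarith
  nlinarith [mul_le_mul_of_nonneg_right h (by positivity : 0 ≤ 2 * a)]

/-- A set of lattice points of a triangle has at most as many elements as the area of the triangle, up to
an error linear in the side lengths. -/
theorem card_le_of_subset_triangle {a b x : ℝ} (ha : 0 < a) (hb : 0 < b) (hx : 0 ≤ x)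
    {D : Finset (ℕ × ℕ)} (hD : ∀ t ∈ D, t.1 * a + t.2 * b ≤ x) :
    (D.card : ℝ) ≤ x ^ 2 / (2 * a * b) + (x + b) / (2 * a) + (x / b + 1) := by
  set B := ⌊x / b⌋₊ with hB
  have hB1 : B * b ≤ x := (le_div_iff₀ hb).1 (Nat.floor_le (by positivity))
  have hB2 : x < (B + 1) * b := (div_lt_iff₀ hb).1 (Nat.lt_floor_add_one _)
  set W := (Finset.range (B + 1)).sigma fun j => Finset.range (⌊(x - j * b) / a⌋₊ + 1) with hW
  have hDW : D.card ≤ W.card := by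
    refine Finset.card_le_card_of_injOn (fun t => ⟨t.2, t.1⟩) ?_ ?_
    · rintro ⟨i, j⟩ ht
      have h := hD _ ht
      simp only at h
      have hi : (0 : ℝ) ≤ i * a := by positivity
      have hj : (0 : ℝ) ≤ j * b := by positivity
      simp only [hW, Finset.coe_sigma, Set.mem_sigma_iff, Finset.mem_coe, Finset.mem_range,
        Nat.lt_succ_iff]
      exact ⟨Nat.le_floor ((le_div_iff₀ hb).2 (by linarith)),
        Nat.le_floor ((le_div_iff₀ ha).2 (by linarith))⟩
    · rintro ⟨i, j⟩ - ⟨i', j'⟩ - h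
      simp only [Sigma.mk.injEq, heq_eq_eq] at h
      rw [h.1, h.2]
  have hsum : (W.card : ℝ) ≤ ∑ j ∈ Finset.range (B + 1), ((x - j * b) / a + 1) := by
    rw [hW, Finset.card_sigma]
    push_cast
    refine Finset.sum_le_sum fun j hj => ?_
    have hj' : (j : ℝ) ≤ B := Nat.cast_le.2 (Nat.lt_succ_iff.1 (Finset.mem_range.1 hj))
    have h0 : 0 ≤ x - j * b := by nlinarith
    rw [Finset.card_range]
    push_cast
    have := Nat.floor_le (show 0 ≤ (x - j * b) / a by positivity)
    linarith
  rw [Finset.sum_add_distrib, ← Finset.sum_div, sum_range_sub_mul, Finset.sum_const,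
    Finset.card_range, nsmul_eq_mul, mul_one] at hsum
  refine (Nat.cast_le.2 hDW).trans (hsum.trans (add_le_add ?_ ?_))
  · rw [div_div, div_add_div _ _ (by positivity) (by positivity),
      div_le_div_iff₀ (by positivity) (by positivity)]
    have h : ((B : ℝ) + 1) * (2 * x - B * b) * b ≤ x ^ 2 + (x + b) * b := by nlinarith
    nlinarith [mul_le_mul_of_nonneg_right h (by positivity : 0 ≤ 4 * a ^ 2)]
  · push_cast
    have : (B : ℝ) ≤ x / b := Nat.floor_le (by positivity)
    linarith

/-! ### From exponent pairs to expressions -/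

theorem pow_mul_pow_injective {p q : ℕ} (hp : 1 < p) (hq : 1 < q) (hpq : Nat.Coprime p q) :
    Function.Injective fun t : ℕ × ℕ => p ^ t.1 * q ^ t.2 := by
  have key : ∀ {a b c d : ℕ}, p ^ a * q ^ b = p ^ c * q ^ d → a ≤ c ∧ b ≤ d := by
    intro a b c d h
    constructor
    · have h1 : p ^ a ∣ p ^ c * q ^ d := h ▸ dvd_mul_right _ _
      exact (Nat.pow_dvd_pow_iff_le_right hp).1 ((hpq.pow a d).dvd_of_dvd_mul_right h1)
    · have h1 : q ^ b ∣ p ^ c * q ^ d := h ▸ dvd_mul_left _ _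
      exact (Nat.pow_dvd_pow_iff_le_right hq).1 ((hpq.symm.pow b c).dvd_of_dvd_mul_left h1)
  rintro ⟨a, b⟩ ⟨c, d⟩ h
  obtain ⟨h1, h2⟩ := key h
  obtain ⟨h3, h4⟩ := key h.symm
  exact Prod.ext (h1.antisymm h3) (h2.antisymm h4)

theorem image_mem_expressions {p q : ℕ} (hp : 1 < p) (hq : 1 < q) (hpq : Nat.Coprime p q)
    (A : Finset (ℕ × ℕ)) :
    A.image (fun t => p ^ t.1 * q ^ t.2) ∈ expressions p q (expSum p q A) := by
  refine ⟨fun m hm => ?_, Finset.sum_image fun _ _ _ _ h => pow_mul_pow_injective hp hq hpq h⟩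
  obtain ⟨t, -, rfl⟩ := Finset.mem_image.1 hm
  exact ⟨t.1, t.2, rfl⟩

theorem numExpressions_le_two_pow {p q n : ℕ} {D : Finset (ℕ × ℕ)}
    (hD : ∀ i j, p ^ i * q ^ j ≤ n → (i, j) ∈ D) : numExpressions p q n ≤ 2 ^ D.card := by
  have hsub : expressions p q n ⊆ (D.image fun t => p ^ t.1 * q ^ t.2).powerset := by
    rintro S ⟨hS, hsum⟩
    rw [Finset.mem_coe, Finset.mem_powerset]
    intro m hm
    obtain ⟨i, j, rfl⟩ := hS m hm
    have hle : p ^ i * q ^ j ≤ n :=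
      hsum ▸ Finset.single_le_sum (f := fun m : ℕ => m) (fun _ _ => Nat.zero_le _) hm
    exact Finset.mem_image.2 ⟨(i, j), hD i j hle, rfl⟩
  calc numExpressions p q n
      ≤ Set.ncard ((D.image fun t => p ^ t.1 * q ^ t.2).powerset : Set (Finset ℕ)) :=
        Set.ncard_le_ncard hsub (Finset.finite_toSet _)
    _ = 2 ^ (D.image fun t => p ^ t.1 * q ^ t.2).card := by
        rw [Set.ncard_coe_finset, Finset.card_powerset]
    _ ≤ 2 ^ D.card := Nat.pow_le_pow_right (by norm_num) Finset.card_image_le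

/-- Terms with `q`-exponent at least `J` may be chosen freely as long as their sum leaves a remainder large
enough to be a sum of terms with `q`-exponent below `J`. -/
theorem two_pow_le_numExpressions {p q J n₀ n : ℕ} (hp : 1 < p) (hq : 1 < q)
    (hpq : Nat.Coprime p q)
    (hJ : ∀ n, n₀ ≤ n → ∃ A : Finset (ℕ × ℕ), (∀ t ∈ A, t.2 < J) ∧ expSum p q A = n)
    {D : Finset (ℕ × ℕ)} (hD : ∀ t ∈ D, J ≤ t.2) (hn : expSum p q D + n₀ ≤ n) :
    2 ^ D.card ≤ numExpressions p q n := by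
  have hle : ∀ S ⊆ D, expSum p q S ≤ expSum p q D := fun S hS => Finset.sum_le_sum_of_subset hS
  have hex : ∀ S, ∃ A : Finset (ℕ × ℕ), S ⊆ D →
      (∀ t ∈ A, t.2 < J) ∧ expSum p q A = n - expSum p q S := by
    intro S
    by_cases hS : S ⊆ D
    · have := hle S hS
      obtain ⟨A, hA⟩ := hJ (n - expSum p q S) (by omega)
      exact ⟨A, fun _ => hA⟩
    · exact ⟨∅, fun h => absurd h hS⟩
  choose A hA using hex
  rw [← Finset.card_powerset, ← Set.ncard_coe_finset]
  refine Set.ncard_le_ncard_of_injOn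
    (fun S => (S ∪ A S).image fun t => p ^ t.1 * q ^ t.2) ?_ ?_ (expressions_finite p q n)
  · intro S hS
    rw [Finset.mem_coe, Finset.mem_powerset] at hS
    have hdisj : Disjoint S (A S) := by
      rw [Finset.disjoint_left]
      intro t h1 h2
      exact absurd ((hA S hS).1 t h2) (not_lt.2 (hD t (hS h1)))
    have hsum : expSum p q (S ∪ A S) = n := by
      rw [expSum_union p q hdisj, (hA S hS).2]
      have := hle S hS
      omega
    exact hsum ▸ image_mem_expressions hp hq hpq (S ∪ A S)
  · -- `S` is recovered from the expression as the set of its terms with `q`-exponent at least `J`.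
    have hrec : ∀ S ⊆ D, (S ∪ A S).filter (fun t => J ≤ t.2) = S := by
      intro S hS
      ext t
      simp only [Finset.mem_filter, Finset.mem_union]
      constructor
      · rintro ⟨h | h, ht⟩
        · exact h
        · exact absurd ((hA S hS).1 t h) (not_lt.2 ht)
      · exact fun h => ⟨Or.inl h, hD t (hS h)⟩
    intro S hS T hT h
    rw [Finset.mem_coe, Finset.mem_powerset] at hS hT
    rw [← hrec S hS, ← hrec T hT,
      Finset.image_injective (pow_mul_pow_injective hp hq hpq) h]

/-! ### The asymptotic bounds -/

theorem log_pow_mul_pow {p q : ℕ} (hp : 1 < p) (hq : 1 < q) (i j : ℕ) :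
    Real.log ((p ^ i * q ^ j : ℕ) : ℝ) = i * Real.log p + j * Real.log q := by
  have hp0 : (p : ℝ) ≠ 0 := by positivity
  have hq0 : (q : ℝ) ≠ 0 := by positivity
  push_cast
  rw [Real.log_mul (pow_ne_zero _ hp0) (pow_ne_zero _ hq0), Real.log_pow, Real.log_pow]

theorem exists_finset_pow_mul_pow_le {p q : ℕ} (hp : 1 < p) (hq : 1 < q) (y : ℝ) :
    ∃ D : Finset (ℕ × ℕ), ∀ i j, (i, j) ∈ D ↔ ((p ^ i * q ^ j : ℕ) : ℝ) ≤ y := by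
  have hfin : {t : ℕ × ℕ | ((p ^ t.1 * q ^ t.2 : ℕ) : ℝ) ≤ y}.Finite := by
    refine ((Finset.range (⌊y⌋₊ + 1)) ×ˢ (Finset.range (⌊y⌋₊ + 1))).finite_toSet.subset ?_
    rintro ⟨i, j⟩ h
    have h1 : p ^ i * q ^ j ≤ ⌊y⌋₊ := Nat.le_floor h
    have hi : i < p ^ i := Nat.lt_pow_self hp
    have hj : j < q ^ j := Nat.lt_pow_self hq
    rw [Finset.mem_coe, Finset.mem_product, Finset.mem_range, Finset.mem_range]
    constructor <;> simp only <;> nlinarith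
  exact ⟨hfin.toFinset, fun i j => by simp⟩

theorem exists_card_le {p q : ℕ} (hp : 1 < p) (hq : 1 < q) :
    ∃ C : ℝ, 0 < C ∧ ∀ (n : ℕ) (D : Finset (ℕ × ℕ)), 1 ≤ Real.log n →
      (∀ t ∈ D, p ^ t.1 * q ^ t.2 ≤ n) →
      (D.card : ℝ) ≤ Real.log n ^ 2 / (2 * Real.log p * Real.log q) + C * Real.log n := by
  have ha : 0 < Real.log p := Real.log_pos (by exact_mod_cast hp)
  have hb : 0 < Real.log q := Real.log_pos (by exact_mod_cast hq)
  set a := Real.log p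
  set b := Real.log q
  refine ⟨(1 + b) / (2 * a) + (1 / b + 1), by positivity, fun n D hn hD => ?_⟩
  have h := card_le_of_subset_triangle ha hb (by linarith : 0 ≤ Real.log n) (D := D) ?_
  · refine h.trans ?_
    have h1 : (Real.log n + b) / (2 * a) ≤ (1 + b) / (2 * a) * Real.log n := by
      rw [div_mul_eq_mul_div]
      gcongr
      nlinarith
    have h2 : Real.log n / b + 1 ≤ (1 / b + 1) * Real.log n := by
      rw [add_mul, one_mul, one_div_mul_eq_div]
      linarith
    linarith
  · intro t ht
    rw [← log_pow_mul_pow hp hq]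
    have hpos : 0 < p ^ t.1 * q ^ t.2 := by positivity
    exact Real.log_le_log (by exact_mod_cast hpos) (by exact_mod_cast hD t ht)

theorem exists_logb_numExpressions_le {p q : ℕ} (hp : 1 < p) (hq : 1 < q) :
    ∃ C : ℝ, 0 < C ∧ ∀ n : ℕ, 1 ≤ Real.log n → 0 < numExpressions p q n →
      Real.logb 2 (numExpressions p q n) ≤
        Real.log n ^ 2 / (2 * Real.log p * Real.log q) + C * Real.log n := by
  obtain ⟨C, hC, h⟩ := exists_card_le hp hq
  refine ⟨C, hC, fun n hn hpos => ?_⟩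
  obtain ⟨D, hD⟩ := exists_finset_pow_mul_pow_le hp hq n
  have h1 : numExpressions p q n ≤ 2 ^ D.card :=
    numExpressions_le_two_pow fun i j hij => (hD i j).2 (Nat.cast_le.2 hij)
  refine le_trans ?_ (h n D hn fun t ht => Nat.cast_le.1 ((hD t.1 t.2).1 ht))
  rw [Real.logb_le_iff_le_rpow (by norm_num) (by exact_mod_cast hpos), Real.rpow_natCast]
  exact_mod_cast h1

/-- The free terms are `q ^ J` times the terms up to `n / (log n) ^ 3`: there are `O((log n) ^ 2)` of them,
so their sum is `o(n)`. -/
theorem eventually_le_logb_numExpressions {p q : ℕ} (hp : 1 < p) (hq : 1 < q)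
    (hpq : Nat.Coprime p q) :
    ∀ᶠ n : ℕ in atTop, 0 < numExpressions p q n ∧
      (Real.log n - 3 * Real.log (Real.log n)) ^ 2 / (2 * Real.log p * Real.log q) ≤
        Real.logb 2 (numExpressions p q n) := by
  obtain ⟨J, n₀, hJ⟩ := exists_expSum_eq_of_le hp hq hpq
  obtain ⟨C, hC, hcard⟩ := exists_card_le hp hq
  have ha : 0 < Real.log p := Real.log_pos (by exact_mod_cast hp)
  have hb : 0 < Real.log q := Real.log_pos (by exact_mod_cast hq)
  have hlog : Tendsto (fun n : ℕ => Real.log n) atTop atTop :=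
    Real.tendsto_log_atTop.comp tendsto_natCast_atTop_atTop
  have hloglog : ∀ᶠ n : ℕ in atTop, Real.log (Real.log n) ≤ 1 / 3 * Real.log n := by
    filter_upwards [hlog.eventually (Real.isLittleO_log_id_atTop.bound (by norm_num : (0:ℝ) < 1 / 3)),
      hlog.eventually_ge_atTop 1] with n h h1
    rw [id, Real.norm_of_nonneg (by linarith : 0 ≤ Real.log (n : ℝ))] at h
    exact (Real.le_norm_self _).trans h
  set c := 1 / (2 * Real.log p * Real.log q) with hc
  have hc0 : 0 < c := by positivity
  filter_upwards [hlog.eventually_ge_atTop 1, hloglog, eventually_ge_atTop (2 * n₀),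
    hlog.eventually_ge_atTop (2 * (q ^ J * (c + C))), eventually_gt_atTop 0] with n hL hll hn hLJ hn0
  set L := Real.log n with hLdef
  have hn0' : (0 : ℝ) < n := by exact_mod_cast hn0
  have hL0 : 0 < L := by linarith
  set y : ℝ := n / L ^ 3 with hy
  have hy0 : 0 < y := by positivity
  have hyn : y ≤ n := div_le_self hn0'.le (one_le_pow₀ hL)
  have hlogy : Real.log y = L - 3 * Real.log L := by
    rw [hy, Real.log_div hn0'.ne' (by positivity), Real.log_pow, ← hLdef]
    norm_num
  obtain ⟨D, hD⟩ := exists_finset_pow_mul_pow_le hp hq y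
  obtain ⟨D', hD', hD's, hD'c⟩ := exists_expSum_shift p q 0 J D
  have hDcard : (D.card : ℝ) ≤ (c + C) * L ^ 2 := by
    refine (hcard n D hL fun t ht => ?_).trans ?_
    · exact_mod_cast ((hD t.1 t.2).1 ht).trans hyn
    · have h1 : L ^ 2 / (2 * Real.log p * Real.log q) = c * L ^ 2 := by
        rw [hc, one_div_mul_eq_div]
      rw [← hLdef, h1, add_mul]
      have h2 : L ≤ L ^ 2 := by nlinarith
      nlinarith
  have hDsum : (expSum p q D : ℝ) ≤ D.card * y := by
    unfold expSum
    push_cast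
    rw [← nsmul_eq_mul]
    refine Finset.sum_le_card_nsmul _ _ _ fun t ht => ?_
    exact_mod_cast (hD t.1 t.2).1 ht
  have hD'sum : 2 * (expSum p q D' : ℝ) ≤ n := by
    rw [hD's, pow_zero, one_mul]
    push_cast
    calc 2 * ((q : ℝ) ^ J * expSum p q D)
        ≤ 2 * ((q : ℝ) ^ J * ((c + C) * L ^ 2 * y)) := by gcongr; exact hDsum.trans (by gcongr)
      _ = 2 * (q ^ J * (c + C)) * (L ^ 2 * y) := by ring
      _ ≤ L * (L ^ 2 * y) := by gcongr
      _ = n := by rw [hy]; field_simp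
  have hmain : 2 ^ D.card ≤ numExpressions p q n := by
    rw [← hD'c]
    refine two_pow_le_numExpressions hp hq hpq hJ ?_ ?_
    · intro t ht
      obtain ⟨s, -, rfl⟩ := hD' t ht
      exact Nat.le_add_left _ _
    · have : 2 * expSum p q D' ≤ n := by exact_mod_cast hD'sum
      omega
  have hpos : 0 < numExpressions p q n := lt_of_lt_of_le (by positivity) hmain
  refine ⟨hpos, ?_⟩
  have hD2 : (D.card : ℝ) ≤ Real.logb 2 (numExpressions p q n) := by
    rw [Real.le_logb_iff_rpow_le (by norm_num) (by exact_mod_cast hpos), Real.rpow_natCast]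
    exact_mod_cast hmain
  refine le_trans ?_ hD2
  rw [← hlogy]
  refine le_card_of_triangle_subset ha hb (by rw [hlogy]; linarith) fun i j hij => ?_
  have hterm : 0 < p ^ i * q ^ j := by positivity
  rw [← log_pow_mul_pow hp hq, Real.log_le_log_iff (by exact_mod_cast hterm) hy0] at hij
  exact (hD i j).2 hij

theorem theorem1 (p q : ℕ) (hp : 1 < p) (hq : 1 < q) (hpq : Nat.Coprime p q) :
    ∃ δ : ℕ → ℝ,
      δ =O[atTop] (fun n : ℕ => Real.log (Real.log (n : ℝ)) / Real.log (n : ℝ)) ∧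
      ∀ᶠ n : ℕ in atTop,
        (numExpressions p q n : ℝ) =
          (2 : ℝ) ^ ((Real.log (n : ℝ)) ^ 2 / (2 * Real.log (p : ℝ) * Real.log (q : ℝ)) *
            (1 + δ n)) := by
  have ha : 0 < Real.log p := Real.log_pos (by exact_mod_cast hp)
  have hb : 0 < Real.log q := Real.log_pos (by exact_mod_cast hq)
  obtain ⟨C, hC, hup⟩ := exists_logb_numExpressions_le hp hq
  have hlow := eventually_le_logb_numExpressions hp hq hpq
  have hlog : Tendsto (fun n : ℕ => Real.log n) atTop atTop :=
    Real.tendsto_log_atTop.comp tendsto_natCast_atTop_atTop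
  have hloglog : Tendsto (fun n : ℕ => Real.log (Real.log n)) atTop atTop :=
    Real.tendsto_log_atTop.comp hlog
  set d := 2 * Real.log p * Real.log q with hd
  have hd0 : 0 < d := by positivity
  refine ⟨fun n => Real.logb 2 (numExpressions p q n) / (Real.log n ^ 2 / d) - 1, ?_, ?_⟩
  · refine IsBigO.of_bound (6 + C * d) ?_
    filter_upwards [hlow, hlog.eventually_ge_atTop 1, hloglog.eventually_ge_atTop 1]
      with n hn hL hll
    obtain ⟨hpos, hl⟩ := hn
    have hu := hup n hL hpos
    set L := Real.log n
    set l := Real.log L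
    set E := Real.logb 2 (numExpressions p q n)
    have hL0 : 0 < L := by linarith
    have hl' : (L - 3 * l) ^ 2 ≤ E * d := (div_le_iff₀ hd0).1 hl
    have hu' : E * d ≤ L ^ 2 + C * d * L := by
      calc E * d ≤ (L ^ 2 / d + C * L) * d := by gcongr
        _ = L ^ 2 + C * d * L := by field_simp
    have hCd : 0 < C * d := by positivity
    have heq : E / (L ^ 2 / d) - 1 = (E * d - L ^ 2) / L ^ 2 := by field_simp
    rw [Real.norm_eq_abs, Real.norm_of_nonneg (by positivity : 0 ≤ l / L), heq, abs_div,
      abs_of_pos (by positivity : 0 < L ^ 2), div_le_iff₀ (by positivity)]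
    have hR : (6 + C * d) * (l / L) * L ^ 2 = (6 + C * d) * (l * L) := by field_simp
    have hlL : L ≤ l * L := by nlinarith
    rw [hR, abs_le]
    constructor
    · nlinarith [sq_nonneg l, mul_pos hCd (by linarith : 0 < l * L)]
    · nlinarith [mul_le_mul_of_nonneg_left hlL hCd.le]
  · filter_upwards [hlow, hlog.eventually_ge_atTop 1] with n hn hL
    have hpos := hn.1
    have hL0 : 0 < Real.log n := by linarith
    rw [add_sub_cancel, mul_div_cancel₀ _ (by positivity : Real.log n ^ 2 / d ≠ 0),
      Real.rpow_logb (by norm_num) (by norm_num) (by exact_mod_cast hpos)]
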